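/- Let $n\ge 1$. All representations are finite-dimensional, complex and algebraic. An irreducible representation of $\mathrm{SL}_{2n+1}(\mathbb{C})$ is denoted by $[b_1,\dots,b_{2n}]$, with integers $b_i\ge 0$, if its highest weight (with respect to the diagonal torus and the upper triangular Borel subgroup) is $b_1\varpi_1+\cdots+b_{2n}\varpi_{2n}$, where $\varpi_i=e_1+\cdots+e_i$, that is, $\varpi_i(\mathrm{diag}(t_1,\dots,t_{2n+1}))=t_1\cdots t_i$. An irreducible representation of $\mathrm{Sp}_{2n}(\mathbb{C})$ is denoted by $[a_1,\dots,a_n]$, with integers $a_i\ge 0$, if its highest weight is $a_1\varpi_1+\cdots+a_n\varpi_n$, where $\varpi_i=e_1+\cdots+e_i$, that is, $\varpi_i(\mathrm{diag}(t_1,\dots,t_n,t_1^{-1},\dots,t_n^{-1}))=t_1\cdots t_i$ (with respect to this torus and the Borel subgroup stabilizing the isotropic flag $\langle e_1\rangle\subset\langle e_1,e_2\rangle\subset\cdots\subset\langle e_1,\dots,e_n\rangle$). The central character of an irreducible representation is the character by which the center of the group acts. (1) Every irreducible representation of $\mathrm{SL}_{2n+1}(\mathbb{C})$ that is selfdual has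 trivial central character, and so does every irreducible representation of the form $[a_1,a_2,\dots,a_n,a_n,\dots,a_2,a_1]$ with integers $a_i\ge 0$. (2) For all integers $a_1,\dots,a_n\ge 0$, the representation $[a_1,a_2,\dots,a_n]$ of $\mathrm{Sp}_{2n}(\mathbb{C})$ has a central character of order $\le 2$, and this central character is trivial if and only if $a_1+a_3+a_5+\cdots$ (the sum of the $a_i$ with $i$ odd, $1\le i\le n$) is even. -/

import Mathlib

/-- A complex representation `ρ` of a linear group, embedded in the `m × m` matrices by `ι`, is
algebraic if all its matrix coefficients are polynomials in the matrix entries. (For subgroups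
of `SL`, this is the same as being given by regular functions.) -/
def IsAlgebraicRep {G : Type*} [Group G] {m : Type*} (ι : G → Matrix m m ℂ)
    {V : Type*} [AddCommGroup V] [Module ℂ V] (ρ : Representation ℂ G V) : Prop :=
  ∀ (f : Module.Dual ℂ V) (v : V), ∃ P : MvPolynomial (m × m) ℂ,
    ∀ g : G, f (ρ g v) = MvPolynomial.eval (fun ij : m × m => ι g ij.1 ij.2) P

/-- The character `ω` of the center of `G` is the central character of `ρ`: each central element
`z` acts on `V` as the scalar `ω z`. -/
def IsCentralCharacter {G : Type*} [Group G] {V : Type*} [AddCommGroup V] [Module ℂ V]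
    (ρ : Representation ℂ G V) (ω : Subgroup.center G →* ℂˣ) : Prop :=
  ∀ (z : Subgroup.center G) (v : V), ρ (z : G) v = ((ω z : ℂˣ) : ℂ) • v

/-- A representation is selfdual if it is isomorphic to its contragredient. -/
def IsSelfdualRep {G : Type*} [Group G] {V : Type*} [AddCommGroup V] [Module ℂ V]
    (ρ : Representation ℂ G V) : Prop :=
  Nonempty (ρ.Equiv ρ.dual)

/-- The representation `ρ` of `SL_{m+1}(ℂ)` has a highest weight vector (with respect to the
diagonal torus and the upper triangular Borel subgroup) of weight
`a₁ ϖ₁ + ⋯ + a_m ϖ_m`, where `ϖᵢ = e₁ + ⋯ + eᵢ`: a nonzero vector that is fixed by the upper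
unitriangular matrices and on which a diagonal matrix `diag(t₁, …, t_{m+1})` acts as the scalar
`∏ᵢ (t₁ ⋯ tᵢ) ^ aᵢ`. The number `aᵢ` is written `a (i - 1)`. -/
def SLHasHighestWeight {m : ℕ} (a : Fin m → ℕ) {V : Type*} [AddCommGroup V] [Module ℂ V]
    (ρ : Representation ℂ (Matrix.SpecialLinearGroup (Fin (m + 1)) ℂ) V) : Prop :=
  ∃ v : V, v ≠ 0 ∧
    (∀ u : Matrix.SpecialLinearGroup (Fin (m + 1)) ℂ,
      u.val.BlockTriangular id → (∀ i, u.val i i = 1) → ρ u v = v) ∧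
    (∀ t : Matrix.SpecialLinearGroup (Fin (m + 1)) ℂ, t.val.IsDiag →
      ρ t v = (∏ i : Fin m, (∏ j ∈ Finset.Iic i.castSucc, t.val j j) ^ a i) • v)

/-- The representation `ρ` of `Sp_{2n}(ℂ)` has a highest weight vector of weight
`a₁ ϖ₁ + ⋯ + a_n ϖ_n`, where `ϖᵢ = e₁ + ⋯ + eᵢ`, with respect to the torus of the matrices
`diag(t₁, …, t_n, t₁⁻¹, …, t_n⁻¹)` and the Borel subgroup stabilizing the isotropic flag
`⟨e₁⟩ ⊂ ⟨e₁, e₂⟩ ⊂ ⋯ ⊂ ⟨e₁, …, e_n⟩`. The unipotent radical of the latter consists of the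
symplectic block matrices `(A, B; 0, D)` with `A` upper unitriangular. -/
def SpHasHighestWeight {n : ℕ} (a : Fin n → ℕ) {V : Type*} [AddCommGroup V] [Module ℂ V]
    (ρ : Representation ℂ (Matrix.symplecticGroup (Fin n) ℂ) V) : Prop :=
  ∃ v : V, v ≠ 0 ∧
    (∀ u : Matrix.symplecticGroup (Fin n) ℂ,
      u.val.toBlocks₂₁ = 0 → u.val.toBlocks₁₁.BlockTriangular id →
      (∀ i, u.val.toBlocks₁₁ i i = 1) → ρ u v = v) ∧
    (∀ t : Matrix.symplecticGroup (Fin n) ℂ, t.val.IsDiag →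
      ρ t v = (∏ i : Fin n, (∏ j ∈ Finset.Iic i, t.val (Sum.inl j) (Sum.inl j)) ^ a i) • v)

/-- The sequence `[a₁, …, a_n, a_n, …, a₁]` of length `2n`. -/
def doubledSeq {n : ℕ} (a : Fin n → ℕ) (i : Fin (2 * n)) : ℕ :=
  if h : (i : ℕ) < n then a ⟨i, h⟩ else a ⟨2 * n - 1 - i, by omega⟩

/-!
By Schur's lemma the center of `G` acts on an irreducible finite-dimensional representation through
a character `ω` (`exists_isCentralCharacter`), so only the values of `ω` remain to be found.

A central element `z` of `SL_{2n+1}(ℂ)` is a scalar matrix with `z ^ (2n+1) = 1`, hence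
`ω z ^ (2n+1) = 1`, and it is enough to see that `ω z ^ 2 = 1`. If the representation is selfdual,
this holds because `z` acts on the dual as `(ω z)⁻¹`. If the highest weight is
`[a₁, …, a_n, a_n, …, a₁]`, then `ω z` is read off from the highest weight vector, and the symmetry
of the weight under `i ↦ 2n + 1 - i` gives the same conclusion.

The center of `Sp_{2n}(ℂ)` is `{1, -1}` (`SymplecticGroup.eq_one_or_eq_neg_one_of_mem_center`):
commuting with the unipotent matrices `(1, B; 0, 1)` and `(1, 0; 1, 1)`, with `B` symmetric, forces
a matrix to be scalar. So `ω ^ 2 = 1`, and `ω` is trivial exactly if `ω (-1) = 1`. On the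
highest weight vector `-1` acts as `∏ᵢ ((-1) ^ i) ^ aᵢ`, to which only the odd `i` contribute.
-/

theorem Representation.IsIrreducible.nontrivial {k G V : Type*} [Field k] [Group G]
    [AddCommGroup V] [Module k V] {ρ : Representation k G V} (hρ : ρ.IsIrreducible) :
    Nontrivial V := by
  by_contra h
  rw [not_nontrivial_iff_subsingleton] at h
  refine bot_ne_top (α := Subrepresentation ρ) (SetLike.ext fun x => ?_)
  rw [Subsingleton.elim x 0]
  exact ⟨fun _ => Submodule.zero_mem _, fun _ => Submodule.zero_mem _⟩

/-- Schur's lemma: an irreducible finite-dimensional representation has a central character. -/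
theorem exists_isCentralCharacter {G : Type*} [Group G] {V : Type*} [AddCommGroup V] [Module ℂ V]
    [FiniteDimensional ℂ V] (ρ : Representation ℂ G V) (hρ : ρ.IsIrreducible) :
    ∃ ω : Subgroup.center G →* ℂˣ, IsCentralCharacter ρ ω := by
  have hscalar (z : Subgroup.center G) : ∃ c : ℂ, ∀ v, ρ (z : G) v = c • v := by
    let f : Representation.IntertwiningMap ρ ρ :=
      ⟨ρ (z : G), fun g => by
        have h : (z : G) * g = g * z := (Subgroup.mem_center_iff.mp z.2 g).symm
        change ρ (z : G) * ρ g = ρ g * ρ (z : G)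
        rw [← map_mul, h, map_mul]⟩
    obtain ⟨c, hc⟩ :=
      Representation.IsIrreducible.algebraMap_intertwiningMap_bijective_of_isAlgClosed.2 f
    exact ⟨c, fun v => (DFunLike.congr_fun hc v).symm⟩
  choose c hc using hscalar
  have := hρ.nontrivial
  obtain ⟨v, hv⟩ := exists_ne (0 : V)
  let χ : Subgroup.center G →* ℂ :=
    { toFun := c
      map_one' := smul_left_injective ℂ hv <| by simp [← hc]
      map_mul' := fun z w => smul_left_injective ℂ hv <| by
        simp only [← hc, mul_smul, Subgroup.coe_mul, map_mul, Module.End.mul_apply] }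
  exact ⟨χ.toHomUnits, fun z v => hc z v⟩

theorem eq_one_of_sq_eq_one_of_pow_odd_eq_one {M : Type*} [Monoid M] {x : M} {n : ℕ}
    (h : x ^ 2 = 1) (h' : x ^ (2 * n + 1) = 1) : x = 1 := by
  rwa [pow_succ, pow_mul, h, one_pow, one_mul] at h'

/-- The center of `SL_{2n+1}(ℂ)` has odd exponent, so it has no nontrivial character of order
two. -/
theorem IsCentralCharacter.eq_one_of_forall_sq_eq_one {n : ℕ} {V : Type*} [AddCommGroup V]
    [Module ℂ V] {ρ : Representation ℂ (Matrix.SpecialLinearGroup (Fin (2 * n + 1)) ℂ) V}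
    {ω : Subgroup.center (Matrix.SpecialLinearGroup (Fin (2 * n + 1)) ℂ) →* ℂˣ}
    (hω : IsCentralCharacter ρ ω) (hsq : ∀ z, ω z ^ 2 = 1) : IsCentralCharacter ρ 1 := by
  have hω1 : ω = 1 := by
    ext1 z
    refine eq_one_of_sq_eq_one_of_pow_odd_eq_one (n := n) (hsq z) ?_
    obtain ⟨r, hr, hz⟩ := Matrix.SpecialLinearGroup.mem_center_iff.mp z.2
    rw [Fintype.card_fin] at hr
    have hz1 : z ^ (2 * n + 1) = 1 := by
      refine Subtype.ext (Subtype.ext ?_)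
      simp only [Subgroup.coe_pow, Subgroup.coe_one, Matrix.SpecialLinearGroup.coe_pow,
        Matrix.SpecialLinearGroup.coe_one]
      rw [← hz, ← map_pow, hr, map_one]
    rw [← map_pow, hz1, map_one]
  exact hω1 ▸ hω

/-- On a selfdual representation a central element acts as a scalar that equals its inverse. -/
theorem IsCentralCharacter.sq_eq_one_of_isSelfdualRep {G : Type*} [Group G] {V : Type*}
    [AddCommGroup V] [Module ℂ V] [Nontrivial V] {ρ : Representation ℂ G V}
    {ω : Subgroup.center G →* ℂˣ} (hω : IsCentralCharacter ρ ω) (hdual : IsSelfdualRep ρ)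
    (z : Subgroup.center G) : ω z ^ 2 = 1 := by
  obtain ⟨φ⟩ := hdual
  obtain ⟨v, hv⟩ := exists_ne (0 : V)
  have hφ : φ v ≠ 0 := fun h => hv (φ.toLinearEquiv.map_eq_zero_iff.mp h)
  have hdualz : ρ.dual (z : G) (φ v) = ((ω z)⁻¹ : ℂˣ).val • φ v := by
    ext w
    have := hω z⁻¹ w
    rw [map_inv ω, Subgroup.coe_inv] at this
    rw [Representation.dual_apply, Module.Dual.transpose_apply, LinearMap.comp_apply, this, map_smul,
      LinearMap.smul_apply]
  have h := Representation.IntertwiningMap.isIntertwining _ _ φ.toIntertwiningMap (z : G) v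
  rw [hω z v, map_smul] at h
  have h' : (ω z).val = ((ω z)⁻¹ : ℂˣ).val := smul_left_injective ℂ hφ (h.trans hdualz)
  rw [sq, mul_eq_one_iff_eq_inv]
  exact Units.ext h'

theorem doubledSeq_rev {n : ℕ} (a : Fin n → ℕ) (i : Fin (2 * n)) :
    doubledSeq a i.rev = doubledSeq a i := by
  unfold doubledSeq
  have := i.2
  simp only [Fin.val_rev]
  split_ifs <;> first | omega | (congr 1; ext; simp; try omega)

/-- If `r ^ (2n+1) = 1`, then the weight `[a₁, …, a_n, a_n, …, a₁]` takes the value `±1` at the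
scalar matrix `r`. -/
theorem prod_pow_doubledSeq_sq {n : ℕ} (a : Fin n → ℕ) {r : ℂ} (hr : r ^ (2 * n + 1) = 1) :
    (∏ i : Fin (2 * n), (r ^ (i.val + 1)) ^ doubledSeq a i) ^ 2 = 1 := by
  -- Multiply the product with its reflection under `i ↦ 2n - 1 - i`.
  have hrev : ∏ i : Fin (2 * n), (r ^ (i.val + 1)) ^ doubledSeq a i
      = ∏ i : Fin (2 * n), (r ^ (i.rev.val + 1)) ^ doubledSeq a i := by
    rw [← Equiv.prod_comp Fin.revPerm]
    simp [doubledSeq_rev]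
  rw [sq]
  nth_rewrite 2 [hrev]
  rw [← Finset.prod_mul_distrib]
  refine Finset.prod_eq_one fun i _ => ?_
  have hi : i.val + 1 + (i.rev.val + 1) = 2 * n + 1 := by
    rw [Fin.val_rev]
    omega
  rw [← mul_pow, ← pow_add, hi, hr, one_pow]

theorem IsCentralCharacter.sq_eq_one_of_slHasHighestWeight {n : ℕ} {V : Type*} [AddCommGroup V]
    [Module ℂ V] {ρ : Representation ℂ (Matrix.SpecialLinearGroup (Fin (2 * n + 1)) ℂ) V}
    {ω : Subgroup.center (Matrix.SpecialLinearGroup (Fin (2 * n + 1)) ℂ) →* ℂˣ}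
    (hω : IsCentralCharacter ρ ω) {a : Fin n → ℕ} (ha : SLHasHighestWeight (doubledSeq a) ρ)
    (z : Subgroup.center (Matrix.SpecialLinearGroup (Fin (2 * n + 1)) ℂ)) : ω z ^ 2 = 1 := by
  obtain ⟨v, hv, -, htorus⟩ := ha
  obtain ⟨r, hr, hz⟩ := Matrix.SpecialLinearGroup.mem_center_iff.mp z.2
  rw [Fintype.card_fin] at hr
  have hdiag : (z : Matrix.SpecialLinearGroup (Fin (2 * n + 1)) ℂ).val.IsDiag := by
    rw [← hz, Matrix.scalar_apply]
    exact Matrix.isDiag_diagonal _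
  have h := smul_left_injective ℂ hv ((hω z v).symm.trans (htorus z hdiag))
  refine Units.ext ?_
  have hentry (j : Fin (2 * n + 1)) :
      (z : Matrix.SpecialLinearGroup (Fin (2 * n + 1)) ℂ).val j j = r :=
    (congrFun (congrFun hz j) j).symm.trans (by simp)
  simp only [hentry, Finset.prod_const, Fin.card_Iic, Fin.val_castSucc] at h
  rw [Units.val_pow_eq_pow_val, Units.val_one, h, prod_pow_doubledSeq_sq a hr]

namespace SymplecticGroup

open Matrix

variable {n : ℕ}

/-- The center of `Sp_{2n}(ℂ)` consists of `1` and `-1`. -/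
theorem eq_one_or_eq_neg_one_of_mem_center {z : symplecticGroup (Fin n) ℂ}
    (hz : z ∈ Subgroup.center (symplecticGroup (Fin n) ℂ)) : z.val = 1 ∨ z.val = -1 := by
  have hcomm (g : Matrix (Fin n ⊕ Fin n) (Fin n ⊕ Fin n) ℂ) (hg : g ∈ symplecticGroup (Fin n) ℂ) :
      g * z.val = z.val * g :=
    congrArg Subtype.val (Subgroup.mem_center_iff.mp hz ⟨g, hg⟩)
  obtain ⟨A, B, C, D, hABCD⟩ : ∃ A B C D, z.val = fromBlocks A B C D :=
    ⟨_, _, _, _, (fromBlocks_toBlocks z.val).symm⟩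
  have hupper (S : Matrix (Fin n) (Fin n) ℂ) (hS : Sᵀ = S) : S * C = 0 ∧ S * D = A * S := by
    have h := hcomm (fromBlocks 1 S 0 1) (fromBlocks_mem_iff.mpr (by simp [hS]))
    rw [hABCD, fromBlocks_multiply, fromBlocks_multiply] at h
    obtain ⟨h1, h2, -, -⟩ := fromBlocks_inj.mp h
    simp only [Matrix.one_mul, Matrix.mul_one, Matrix.mul_zero, add_zero] at h1 h2
    exact ⟨add_eq_left.mp h1, add_left_cancel (h2.trans (add_comm _ _))⟩
  obtain ⟨hC, hDA⟩ := hupper 1 transpose_one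
  rw [Matrix.one_mul] at hC
  rw [Matrix.one_mul, Matrix.mul_one] at hDA
  have hB : B = 0 := by
    have h := hcomm (fromBlocks 1 0 1 1) (fromBlocks_mem_iff.mpr (by simp))
    rw [hABCD, fromBlocks_multiply, fromBlocks_multiply] at h
    obtain ⟨h1, -, -, -⟩ := fromBlocks_inj.mp h
    simp only [Matrix.one_mul, Matrix.mul_one, Matrix.zero_mul, add_zero] at h1
    exact left_eq_add.mp h1
  have hsymm (S : Matrix (Fin n) (Fin n) ℂ) (hS : Sᵀ = S) : Commute S A :=
    hDA ▸ (hupper S hS).2.trans (by rw [hDA])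
  -- An off-diagonal elementary matrix is a product of two symmetric matrices.
  have hA : A ∈ Set.range (scalar (Fin n)) := by
    refine mem_range_scalar_of_commute_single fun i j hij => ?_
    have h : single i j (1 : ℂ) = single i i 1 * (single i j 1 + single j i 1) := by
      rw [Matrix.mul_add, single_mul_single_same, single_mul_single_of_ne _ _ _ _ hij, add_zero,
        one_mul]
    change Commute (single i j 1) A
    rw [h]
    exact (hsymm _ (by simp)).mul_left (hsymm _ (by simp [add_comm]))
  obtain ⟨s, hs⟩ := hA
  have hzs : z.val = s • 1 := by
    rw [hABCD, hC, hB, hDA, ← hs, ← fromBlocks_one, fromBlocks_smul]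
    simp [smul_one_eq_diagonal]
  rcases isEmpty_or_nonempty (Fin n) with hn | ⟨⟨i⟩⟩
  · exact Or.inl (Subsingleton.elim _ _)
  have hs2 : s * s = 1 := by
    have h := (fromBlocks_mem_iff.mp (hABCD ▸ z.2)).2.2
    rw [hC, hDA, ← hs, transpose_zero, Matrix.zero_mul, sub_zero] at h
    simpa using congrFun (congrFun h i) i
  rcases mul_self_eq_one_iff.mp hs2 with rfl | rfl
  · exact Or.inl (by rw [hzs, one_smul])
  · exact Or.inr (by rw [hzs, neg_one_smul])

variable (n) in
/-- The element `-1` of the center of `Sp_{2n}(ℂ)`. -/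
def negOneCenter : Subgroup.center (symplecticGroup (Fin n) ℂ) :=
  ⟨⟨-1, neg_mem (one_mem _)⟩, Subgroup.mem_center_iff.mpr fun g => Subtype.ext <| by simp⟩

theorem eq_one_or_eq_negOneCenter (z : Subgroup.center (symplecticGroup (Fin n) ℂ)) :
    z = 1 ∨ z = negOneCenter n :=
  (eq_one_or_eq_neg_one_of_mem_center z.2).imp (fun h => Subtype.ext (Subtype.ext h))
    fun h => Subtype.ext (Subtype.ext h)

theorem negOneCenter_sq : negOneCenter n ^ 2 = 1 :=
  Subtype.ext <| Subtype.ext <| by simp [negOneCenter]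

end SymplecticGroup

open SymplecticGroup in
theorem IsCentralCharacter.apply_negOneCenter {n : ℕ} {V : Type*} [AddCommGroup V] [Module ℂ V]
    {ρ : Representation ℂ (Matrix.symplecticGroup (Fin n) ℂ) V}
    {ω : Subgroup.center (Matrix.symplecticGroup (Fin n) ℂ) →* ℂˣ}
    (hω : IsCentralCharacter ρ ω) {a : Fin n → ℕ} (ha : SpHasHighestWeight a ρ) :
    (ω (negOneCenter n) : ℂ) = (-1) ^ ∑ i : Fin n with Odd (i.val + 1), a i := by
  obtain ⟨v, hv, -, htorus⟩ := ha
  have hdiag : (negOneCenter n).val.val.IsDiag := Matrix.isDiag_one.neg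
  have h := smul_left_injective ℂ hv ((hω (negOneCenter n) v).symm.trans (htorus _ hdiag))
  rw [h, ← Finset.prod_pow_eq_pow_sum, Finset.prod_filter]
  refine Finset.prod_congr rfl fun i _ => ?_
  have hentry (j : Fin n) : (negOneCenter n).val.val (Sum.inl j) (Sum.inl j) = -1 := by
    simp [negOneCenter]
  simp only [hentry, Finset.prod_const, Fin.card_Iic]
  split_ifs with hi
  · rw [hi.neg_one_pow]
  · rw [(Nat.not_odd_iff_even.mp hi).neg_one_pow, one_pow]

theorem lemma2 (n : ℕ) (V : Type*) [AddCommGroup V] [Module ℂ V] [FiniteDimensional ℂ V] :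
    -- selfdual irreducible representations of `SL_{2n+1}(ℂ)`
    (∀ ρ : Representation ℂ (Matrix.SpecialLinearGroup (Fin (2 * n + 1)) ℂ) V,
      IsAlgebraicRep (fun g => g.val) ρ → ρ.IsIrreducible → IsSelfdualRep ρ →
        IsCentralCharacter ρ 1) ∧
    -- the irreducible representation `[a₁, …, a_n, a_n, …, a₁]` of `SL_{2n+1}(ℂ)`
    (∀ (a : Fin n → ℕ) (ρ : Representation ℂ (Matrix.SpecialLinearGroup (Fin (2 * n + 1)) ℂ) V),
      IsAlgebraicRep (fun g => g.val) ρ → ρ.IsIrreducible →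
      SLHasHighestWeight (doubledSeq a) ρ →
        IsCentralCharacter ρ 1) ∧
    -- the irreducible representation `[a₁, …, a_n]` of `Sp_{2n}(ℂ)`
    (∀ (a : Fin n → ℕ) (ρ : Representation ℂ (Matrix.symplecticGroup (Fin n) ℂ) V),
      IsAlgebraicRep (fun g => g.val) ρ → ρ.IsIrreducible →
      SpHasHighestWeight a ρ →
        ∃ ω : Subgroup.center (Matrix.symplecticGroup (Fin n) ℂ) →* ℂˣ,
          IsCentralCharacter ρ ω ∧ ω ^ 2 = 1 ∧
          (ω = 1 ↔ Even (∑ i : Fin n with Odd (i.val + 1), a i))) := by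
  refine ⟨fun ρ _ hirr hdual => ?_, fun a ρ _ hirr ha => ?_, fun a ρ _ hirr ha => ?_⟩ <;>
    obtain ⟨ω, hω⟩ := exists_isCentralCharacter ρ hirr
  · have := hirr.nontrivial
    exact hω.eq_one_of_forall_sq_eq_one (hω.sq_eq_one_of_isSelfdualRep hdual)
  · exact hω.eq_one_of_forall_sq_eq_one (hω.sq_eq_one_of_slHasHighestWeight ha)
  · refine ⟨ω, hω, ?_, ?_⟩
    · ext1 z
      rcases SymplecticGroup.eq_one_or_eq_negOneCenter z with rfl | rfl
      · simp
      · rw [MonoidHom.pow_apply, ← map_pow, SymplecticGroup.negOneCenter_sq, map_one,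
          MonoidHom.one_apply]
    · rw [← neg_one_pow_eq_one_iff_even (R := ℂ) (by norm_num), ← hω.apply_negOneCenter ha,
        Units.val_eq_one]
      refine ⟨fun h => by rw [h, MonoidHom.one_apply], fun h => ?_⟩
      ext1 z
      rcases SymplecticGroup.eq_one_or_eq_negOneCenter z with rfl | rfl
      · simp
      · exact h
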